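/- Consider $N\ge 1$ parties $X^{(1)},\dots,X^{(N)}$, where party $X^{(i)}$ has an input space $\mathcal H_{X^{(i)}_I}$ and an output space $\mathcal H_{X^{(i)}_O}$ of finite dimensions $d_{X^{(i)}_I},d_{X^{(i)}_O}\ge 1$. A \emph{process} is a matrix $W\ge 0$ on $\bigotimes_i(\mathcal H_{X^{(i)}_I}\otimes\mathcal H_{X^{(i)}_O})$ with $\operatorname{tr}[W^{\mathrm T}(M_1\otimes\cdots\otimes M_N)]=1$ for all Choi matrices $M_i$ of completely positive trace-preserving maps (i.e. $M_i\ge 0$ on $\mathcal H_{X^{(i)}_I}\otimes\mathcal H_{X^{(i)}_O}$ with $\operatorname{tr}_{X^{(i)}_O}M_i=\mathbb 1_{X^{(i)}_I}$); $\mathtt{Proc}$ is the set of all processes. A process is \emph{free} if $W=\rho\otimes\mathbb 1$, with $\rho$ a density matrix on all input spaces and $\mathbb 1$ the identity on all output spaces; $\mathtt{Free}$ is the set of free processes. The \emph{signalling robustness} of a process $W$ is $$\mathcal R_s(W)=\min\Big\{s\ge 0\ \Big|\ \exists\,T\in\mathtt{Proc}:\ \frac{W+sT}{1+s}\in\mathtt{Free}\Big\}.$$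 A process $W$ has $X^{(k)}$ as a \emph{definite last party} if $X^{(k)}$ cannot signal to the others, that is, ${}_{X^{(k)}_O}W=W$, where ${}_{X}W:=\frac{\mathbb 1_X}{d_X}\otimes\operatorname{tr}_XW$. Let $\mathtt{Proc}^{\mathrm{conv}}_{\pi(N)}$ be the convex hull of all processes that have some party as a definite last party. Then for every $W\in\mathtt{Proc}^{\mathrm{conv}}_{\pi(N)}$ the minimum defining $\mathcal R_s(W)$ exists, and $$\mathcal R_s(W)\ \le\ \max_{\pi}\ \Big(\prod_{i=1}^{N-1}d_{X^{(\pi(i))}_O}^{2}-1\Big)=\max_{\bar O}\{d_{\bar O}^2-1\},$$ where the maximum is over all permutations $\pi$ of $\{1,\dots,N\}$ (all orders of the parties), and $d_{\bar O}$ is the product of the output dimensions of all parties except the last one of the order. -/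

import Mathlib

open scoped ComplexOrder

namespace ProcessMatrix

/-- Basis labels of the tensor product, over all parties `i`, of the input space `ℂ ^ dI i` and the
output space `ℂ ^ dO i` of party `i`. -/
abbrev Idx {N : ℕ} (dI dO : Fin N → ℕ) : Type := ∀ i, Fin (dI i) × Fin (dO i)

/-- Operators on the joint space of all inputs and outputs. -/
abbrev Op {N : ℕ} (dI dO : Fin N → ℕ) : Type := Matrix (Idx dI dO) (Idx dI dO) ℂ

/-- `M` is the Choi matrix of a completely positive trace-preserving map from operators on `ℂ ^ a`
(input) to operators on `ℂ ^ b` (output): it is positive semidefinite, and its partial trace over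
the output is the identity on the input. -/
def IsChannelChoi {a b : ℕ} (M : Matrix (Fin a × Fin b) (Fin a × Fin b) ℂ) : Prop :=
  M.PosSemidef ∧
    (Matrix.of fun x y : Fin a => ∑ o : Fin b, M (x, o) (y, o)) = (1 : Matrix (Fin a) (Fin a) ℂ)

/-- The tensor product over all parties of one local operator for each party. -/
def tensorAll {N : ℕ} {dI dO : Fin N → ℕ}
    (M : ∀ i, Matrix (Fin (dI i) × Fin (dO i)) (Fin (dI i) × Fin (dO i)) ℂ) : Op dI dO :=
  Matrix.of fun x y => ∏ i, M i (x i) (y i)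

/-- The set of proper process matrices: positive semidefinite operators that give total probability
one when every party applies a channel. -/
def Proc {N : ℕ} (dI dO : Fin N → ℕ) : Set (Op dI dO) :=
  {W | W.PosSemidef ∧
    ∀ M : ∀ i, Matrix (Fin (dI i) × Fin (dO i)) (Fin (dI i) × Fin (dO i)) ℂ,
      (∀ i, IsChannelChoi (M i)) → (W.transpose * tensorAll M).trace = 1}

/-- The operator `ρ ⊗ 𝟙`, with `ρ` on all input spaces and the identity on all output spaces. -/
def parallel {N : ℕ} {dI dO : Fin N → ℕ}
    (ρ : Matrix (∀ i, Fin (dI i)) (∀ i, Fin (dI i)) ℂ) : Op dI dO :=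
  Matrix.of fun x y =>
    ρ (fun i => (x i).1) (fun i => (y i).1) *
      (1 : Matrix (∀ i, Fin (dO i)) (∀ i, Fin (dO i)) ℂ) (fun i => (x i).2) (fun i => (y i).2)

/-- The free (non-signalling) processes `ρ ⊗ 𝟙`, with `ρ` a density matrix on the inputs. -/
def Free {N : ℕ} (dI dO : Fin N → ℕ) : Set (Op dI dO) :=
  {W | ∃ ρ : Matrix (∀ i, Fin (dI i)) (∀ i, Fin (dI i)) ℂ,
    ρ.PosSemidef ∧ ρ.trace = 1 ∧ W = parallel ρ}

/-- The operation `W ↦ (𝟙 / d) ⊗ tr W` on the output space of party `k`, of dimension `d`: trace out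
this space and replace it by the maximally mixed state. -/
noncomputable def traceReplaceOutput {N : ℕ} {dI dO : Fin N → ℕ} (k : Fin N) (W : Op dI dO) :
    Op dI dO :=
  Matrix.of fun x y =>
    if (x k).2 = (y k).2 then
      (dO k : ℂ)⁻¹ * ∑ o : Fin (dO k),
        W (Function.update x k ((x k).1, o)) (Function.update y k ((y k).1, o))
    else 0

/-- The processes that have party `k` as a definite last party: `k` cannot signal to the others,
i.e. the process matrix is the identity on the output space of `k`. The other parties need not be
causally ordered among themselves. -/
def ProcLast {N : ℕ} (dI dO : Fin N → ℕ) (k : Fin N) : Set (Op dI dO) :=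
  {W | W ∈ Proc dI dO ∧ traceReplaceOutput k W = W}

/-- The convex hull of all processes that have a definite last party. -/
def ProcLastConv {N : ℕ} (dI dO : Fin N → ℕ) : Set (Op dI dO) :=
  convexHull ℝ (⋃ k, ProcLast dI dO k)

/-- The weights `s ≥ 0` such that mixing `W` with some process, with weights proportional to `1` and
`s`, gives a free process. -/
def freeingWeights {N : ℕ} {dI dO : Fin N → ℕ} (W : Op dI dO) : Set ℝ :=
  {s | 0 ≤ s ∧ ∃ T ∈ Proc dI dO, (1 + s)⁻¹ • (W + s • T) ∈ Free dI dO}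

/-- The signalling robustness, the least element of `freeingWeights W`. -/
noncomputable def signallingRobustness {N : ℕ} {dI dO : Fin N → ℕ} (W : Op dI dO) : ℝ :=
  sInf (freeingWeights W)

end ProcessMatrix

/-! Let `N(W)` be `nonSignallingPart W`, which is free. On a factor of dimension `d`, `A ≤ d • (tr A
⊗ 1)`, that is, `A` is at most `d ^ 2` times its trace-and-replace. If `k` is last, `W` is already
maximally mixed on the output of `k`, so only the other outputs cost a factor: `W ≤ D • N(W)`, with
`D` the squared product of their dimensions. As `N` is linear and `N(W) ≥ 0`, the largest `D` serves
the whole convex hull. The remainder `D • N(W) - W`, divided by `D - 1`, is then a process, and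
mixing it with `W` at weight `D - 1` gives `N(W)`. The minimum exists because processes and free
processes form compact sets. -/

open scoped Kronecker

/-! ### Positive semidefinite matrices: pinching and compactness -/

namespace Matrix

variable {α β : Type*} [Fintype α] [Fintype β]

/-- The partial trace over the second tensor factor. -/
def partialTraceSnd (A : Matrix (α × β) (α × β) ℂ) : Matrix α α ℂ :=
  of fun a a' => ∑ b, A (a, b) (a', b)

/-- On a positive operator the identity map is dominated by `card β` times the map which traces out
`β` and replaces it by the identity. -/
theorem PosSemidef.card_smul_partialTraceSnd_kronecker_one_sub [DecidableEq α] [DecidableEq β]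
    {A : Matrix (α × β) (α × β) ℂ} (hA : A.PosSemidef) :
    ((Fintype.card β : ℝ) • (partialTraceSnd A ⊗ₖ (1 : Matrix β β ℂ)) - A).PosSemidef := by
  -- With `P_b` the projection onto `b` in the second factor, the last sum is `card β • ∑ P_b A P_b
  -- - A` (the pinching inequality); the first is `card β` times the gap between `tr A ⊗ 1` and the
  -- pinching.
  have key : (Fintype.card β : ℝ) • (partialTraceSnd A ⊗ₖ (1 : Matrix β β ℂ)) - A =
      (Fintype.card β : ℝ) • ∑ b : β, (A.submatrix (fun a => (a, b)) (fun a => (a, b))) ⊗ₖ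
        (diagonal fun c : β => if c = b then (0 : ℂ) else 1) +
      (2⁻¹ : ℝ) • ∑ b : β, ∑ c : β,
        diagonal (fun p : α × β => (if p.2 = b then (1 : ℂ) else 0) - if p.2 = c then 1 else 0) *
          A * (diagonal
            (fun p : α × β => (if p.2 = b then (1 : ℂ) else 0) - if p.2 = c then 1 else 0))ᴴ := by
    ext ⟨a, b⟩ ⟨a', b'⟩
    have h2 : ∑ x : β, ∑ y : β, ((if b = x then (1 : ℂ) else 0) - if b = y then 1 else 0) *
        A (a, b) (a', b') * ((if b' = x then (1 : ℂ) else 0) - if b' = y then 1 else 0) =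
        (2 * Fintype.card β * (if b = b' then 1 else 0) - 2) * A (a, b) (a', b') := by
      simp only [mul_right_comm _ (A (a, b) (a', b')), ← Finset.sum_mul]
      congr 1
      simp only [sub_mul, mul_sub, Finset.sum_sub_distrib]
      by_cases h : b = b'
      · subst h; simp; ring
      · simp [h]; ring
    simp only [sub_apply, add_apply, smul_apply, sum_apply, kroneckerMap_apply, submatrix_apply,
      diagonal_conjTranspose, mul_diagonal, diagonal_mul, Pi.star_apply, star_sub, apply_ite star,
      star_one, star_zero, h2, partialTraceSnd, of_apply, one_apply, diagonal_apply]
    by_cases h : b = b'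
    · subst h
      have h3 : ∑ x : β, A (a, x) (a', x) * (if b = x then 0 else 1) =
          ∑ x : β, A (a, x) (a', x) - A (a, b) (a', b) := by
        rw [eq_sub_iff_add_eq, ← Finset.sum_erase_add _ _ (Finset.mem_univ b),
          ← Finset.sum_erase_add (a := b) _ _ (Finset.mem_univ b)]
        simp only [if_true, mul_zero, add_zero]
        congr 1
        refine Finset.sum_congr rfl fun x hx => ?_
        simp [(Finset.ne_of_mem_erase hx).symm]
      simp only [if_true, h3, Complex.real_smul]
      push_cast
      ring
    · simp only [h, if_false, Complex.real_smul, mul_zero, Finset.sum_const_zero]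
      push_cast
      ring
  rw [key]
  refine .add (.smul (posSemidef_sum _ fun b _ => ?_) (Nat.cast_nonneg _))
    (.smul (posSemidef_sum _ fun b _ => posSemidef_sum _ fun c _ =>
      hA.mul_mul_conjTranspose_same _) (by norm_num))
  refine (hA.submatrix _).kronecker (.diagonal fun c => ?_)
  simp only [Pi.zero_apply]
  split_ifs <;> simp

/-- The 2 × 2 minor on `x`, `y` is nonnegative, so `‖A x y‖ ^ 2` is at most a product of two
diagonal entries; for `x = y` the minor vanishes and the bound still holds. -/
theorem PosSemidef.norm_apply_le_trace {A : Matrix α α ℂ} (hA : A.PosSemidef) (x y : α) :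
    ‖A x y‖ ≤ ‖A.trace‖ := by
  have hd : ∀ i, A i i = (‖A i i‖ : ℂ) := fun i =>
    (Complex.norm_of_nonneg' hA.diag_nonneg).symm
  have ht : A.trace = ((∑ i, ‖A i i‖ : ℝ) : ℂ) := by
    rw [trace, Complex.ofReal_sum]
    exact Finset.sum_congr rfl fun i _ => hd i
  have hle : ∀ i, ‖A i i‖ ≤ ‖A.trace‖ := fun i => by
    rw [ht, Complex.norm_of_nonneg (Finset.sum_nonneg fun _ _ => norm_nonneg _)]
    exact Finset.single_le_sum (f := fun i => ‖A i i‖) (fun _ _ => norm_nonneg _)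
      (Finset.mem_univ i)
  have hdet := (hA.submatrix ![x, y]).det_nonneg
  have hyx : A y x = star (A x y) := (hA.1.apply y x).symm
  simp only [det_fin_two, submatrix_apply, cons_val_zero, cons_val_one] at hdet
  rw [hyx, hd x, hd y, Complex.star_def, Complex.mul_conj, Complex.normSq_eq_norm_sq] at hdet
  have hreal : ‖A x y‖ ^ 2 ≤ ‖A x x‖ * ‖A y y‖ := by
    rw [← sub_nonneg]
    exact_mod_cast hdet
  refine le_of_sq_le_sq ?_ (norm_nonneg _)
  calc ‖A x y‖ ^ 2 ≤ ‖A x x‖ * ‖A y y‖ := hreal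
    _ ≤ ‖A.trace‖ * ‖A.trace‖ := mul_le_mul (hle x) (hle y) (norm_nonneg _) (norm_nonneg _)
    _ = ‖A.trace‖ ^ 2 := (sq _).symm

theorem isClosed_setOf_posSemidef : IsClosed {A : Matrix α α ℂ | A.PosSemidef} := by
  simp only [posSemidef_iff_dotProduct_mulVec, IsHermitian, Set.ofPred_and, Set.ofPred_forall]
  refine (isClosed_eq (by fun_prop) continuous_id).inter (isClosed_iInter fun v => ?_)
  exact isClosed_le continuous_const (by fun_prop)

theorem isCompact_setOf_posSemidef_trace_eq (c : ℂ) :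
    IsCompact {A : Matrix α α ℂ | A.PosSemidef ∧ A.trace = c} := by
  have hK : IsCompact (Set.univ.pi fun _ : α => Set.univ.pi fun _ : α =>
      Metric.closedBall (0 : ℂ) ‖c‖) :=
    isCompact_univ_pi fun _ => isCompact_univ_pi fun _ => isCompact_closedBall _ _
  refine IsCompact.of_isClosed_subset (s := (Set.univ.pi fun _ : α => Set.univ.pi fun _ : α =>
      Metric.closedBall (0 : ℂ) ‖c‖ : Set (Matrix α α ℂ))) hK ?_ ?_
  · exact isClosed_setOf_posSemidef.inter (isClosed_eq (by fun_prop) continuous_const)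
  · rintro A ⟨hA, rfl⟩ x - y -
    simpa using hA.norm_apply_le_trace x y

end Matrix

/-! ### Free processes and the non-signalling part -/

namespace ProcessMatrix

variable {N : ℕ} {dI dO : Fin N → ℕ}

/-- The partial trace over the output spaces of all parties. -/
def traceOutputs (W : Op dI dO) : Matrix (∀ i, Fin (dI i)) (∀ i, Fin (dI i)) ℂ :=
  Matrix.of fun a b => ∑ o : ∀ i, Fin (dO i), W (fun i => (a i, o i)) (fun i => (b i, o i))

/-- Trace out all output spaces and replace them by the maximally mixed state. -/
noncomputable def nonSignallingPart (W : Op dI dO) : Op dI dO :=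
  parallel ((∏ i, (dO i : ℝ))⁻¹ • traceOutputs W)

theorem sum_idx {M : Type*} [AddCommMonoid M] (f : Idx dI dO → M) :
    ∑ x, f x = ∑ a : ∀ i, Fin (dI i), ∑ o : ∀ i, Fin (dO i), f fun i => (a i, o i) := by
  rw [← Fintype.sum_prod_type', ← (Equiv.arrowProdEquivProdArrow _ _ _).symm.sum_comp]
  rfl

theorem trace_traceOutputs (W : Op dI dO) : (traceOutputs W).trace = W.trace := by
  simp only [Matrix.trace, Matrix.diag, sum_idx (fun x => W x x)]
  rfl

theorem posSemidef_traceOutputs {W : Op dI dO} (hW : W.PosSemidef) :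
    (traceOutputs W).PosSemidef := by
  have : traceOutputs W = ∑ o : ∀ i, Fin (dO i), W.submatrix
      (fun (a : ∀ i, Fin (dI i)) i => (a i, o i)) (fun a i => (a i, o i)) := by
    ext a b
    simp [traceOutputs, Matrix.sum_apply]
  rw [this]
  exact Matrix.posSemidef_sum _ fun o _ => hW.submatrix _

theorem traceOutputs_add (V W : Op dI dO) :
    traceOutputs (V + W) = traceOutputs V + traceOutputs W := by
  ext; simp [traceOutputs, Finset.sum_add_distrib]

theorem traceOutputs_smul (c : ℝ) (W : Op dI dO) : traceOutputs (c • W) = c • traceOutputs W := by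
  ext; simp [traceOutputs, Finset.mul_sum]

theorem parallel_add (ρ σ : Matrix (∀ i, Fin (dI i)) (∀ i, Fin (dI i)) ℂ) :
    (parallel (ρ + σ) : Op dI dO) = parallel ρ + parallel σ := by
  ext; simp [parallel, add_mul]

theorem parallel_smul (c : ℝ) (ρ : Matrix (∀ i, Fin (dI i)) (∀ i, Fin (dI i)) ℂ) :
    (parallel (c • ρ) : Op dI dO) = c • parallel ρ := by
  ext; simp [parallel, mul_assoc]

theorem nonSignallingPart_add (V W : Op dI dO) :
    nonSignallingPart (V + W) = nonSignallingPart V + nonSignallingPart W := by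
  simp only [nonSignallingPart, traceOutputs_add, smul_add, parallel_add]

theorem nonSignallingPart_smul (c : ℝ) (W : Op dI dO) :
    nonSignallingPart (c • W) = c • nonSignallingPart W := by
  simp only [nonSignallingPart, traceOutputs_smul, parallel_smul, smul_comm c]

theorem posSemidef_parallel {ρ : Matrix (∀ i, Fin (dI i)) (∀ i, Fin (dI i)) ℂ}
    (hρ : ρ.PosSemidef) : (parallel ρ : Op dI dO).PosSemidef :=
  (hρ.kronecker (Matrix.PosSemidef.one (n := ∀ i, Fin (dO i)))).submatrix
    (fun x : Idx dI dO => (fun i => (x i).1, fun i => (x i).2))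

/-- The identity on the outputs reduces each channel to its partial trace, which is the identity on
the input. -/
theorem trace_transpose_parallel_mul_tensorAll
    (ρ : Matrix (∀ i, Fin (dI i)) (∀ i, Fin (dI i)) ℂ)
    {M : ∀ i, Matrix (Fin (dI i) × Fin (dO i)) (Fin (dI i) × Fin (dO i)) ℂ}
    (hM : ∀ i, IsChannelChoi (M i)) :
    ((parallel ρ : Op dI dO).transpose * tensorAll M).trace = ρ.trace := by
  have hM' : ∀ (i : Fin N) (a b : Fin (dI i)),
      ∑ o, M i (a, o) (b, o) = (1 : Matrix (Fin (dI i)) (Fin (dI i)) ℂ) a b := fun i a b =>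
    congr_fun (congr_fun (hM i).2 a) b
  have hsum : ∀ a b : ∀ i, Fin (dI i), ∑ o : ∀ i, Fin (dO i), ∏ i, M i (a i, o i) (b i, o i) =
      (1 : Matrix (∀ i, Fin (dI i)) (∀ i, Fin (dI i)) ℂ) a b := by
    intro a b
    rw [← Fintype.prod_sum (fun i o => M i (a i, o) (b i, o))]
    simp only [hM', Matrix.one_apply]
    by_cases h : a = b
    · simp [h]
    · obtain ⟨i, hi⟩ := Function.ne_iff.1 h
      rw [if_neg h, Finset.prod_eq_zero (Finset.mem_univ i) (if_neg hi)]
  simp only [Matrix.trace, Matrix.diag, Matrix.mul_apply, Matrix.transpose_apply, sum_idx, parallel,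
    tensorAll, Matrix.of_apply]
  calc _ = ∑ a : ∀ i, Fin (dI i), ∑ b : ∀ i, Fin (dI i), ρ b a *
        ∑ o : ∀ i, Fin (dO i), ∏ i, M i (b i, o i) (a i, o i) := by
        refine Finset.sum_congr rfl fun a _ => ?_
        rw [Finset.sum_comm]
        refine Finset.sum_congr rfl fun b _ => ?_
        rw [Finset.mul_sum]
        refine Finset.sum_congr rfl fun o _ => ?_
        rw [Finset.sum_eq_single o]
        · simp
        · intro o' _ h
          simp [h]
        · simp
    _ = _ := by simp [hsum, Matrix.one_apply]

theorem free_subset_proc : Free dI dO ⊆ Proc dI dO := by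
  rintro _ ⟨ρ, hρ, htr, rfl⟩
  exact ⟨posSemidef_parallel hρ, fun M hM => by
    rw [trace_transpose_parallel_mul_tensorAll ρ hM, htr]⟩

theorem trace_of_mem_proc (hO : ∀ i, 0 < dO i) {W : Op dI dO} (hW : W ∈ Proc dI dO) :
    W.trace = ∏ i, (dO i : ℂ) := by
  have hne : ∀ i, (dO i : ℂ) ≠ 0 := fun i => Nat.cast_ne_zero.2 (hO i).ne'
  -- Test with the completely depolarizing channels, whose Choi matrices are `1 / dO i`.
  have h := hW.2 (fun i => (dO i : ℝ)⁻¹ • 1) fun i =>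
    ⟨Matrix.PosSemidef.one.smul (by positivity), by
      ext a b
      by_cases h : a = b <;> simp [Matrix.one_apply, h, hne]⟩
  have ht : tensorAll (fun i => (dO i : ℝ)⁻¹ •
      (1 : Matrix (Fin (dI i) × Fin (dO i)) (Fin (dI i) × Fin (dO i)) ℂ)) =
      (∏ i, (dO i : ℂ))⁻¹ • (1 : Op dI dO) := by
    ext x y
    by_cases h : x = y
    · simp [tensorAll, h]
    · obtain ⟨i, hi⟩ := Function.ne_iff.1 h
      simp only [tensorAll, Matrix.of_apply, Matrix.smul_apply, Matrix.one_apply, if_neg h, smul_zero]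
      exact Finset.prod_eq_zero (Finset.mem_univ i) (by simp [hi])
  rw [ht, Matrix.mul_smul, mul_one, Matrix.trace_smul, Matrix.trace_transpose, smul_eq_mul,
    inv_mul_eq_one₀ (Finset.prod_ne_zero_iff.2 fun i _ => hne i)] at h
  exact h.symm

theorem nonSignallingPart_mem_free (hO : ∀ i, 0 < dO i) {W : Op dI dO} (hW : W ∈ Proc dI dO) :
    nonSignallingPart W ∈ Free dI dO := by
  refine ⟨_, (posSemidef_traceOutputs hW.1).smul (by positivity), ?_, rfl⟩
  rw [Matrix.trace_smul, trace_traceOutputs, trace_of_mem_proc hO hW, Complex.real_smul]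
  push_cast
  exact inv_mul_cancel₀ (Finset.prod_ne_zero_iff.2 fun i _ => Nat.cast_ne_zero.2 (hO i).ne')

/-! ### Compactness, and existence of the minimum -/

theorem isCompact_proc (hO : ∀ i, 0 < dO i) : IsCompact (Proc dI dO) := by
  refine (Matrix.isCompact_setOf_posSemidef_trace_eq (∏ i, (dO i : ℂ))).of_isClosed_subset ?_
    fun W hW => ⟨hW.1, trace_of_mem_proc hO hW⟩
  have h : IsClosed (⋂ M, ⋂ (_ : ∀ i, IsChannelChoi (M i)),
      {W : Op dI dO | (W.transpose * tensorAll M).trace = 1}) :=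
    isClosed_iInter fun M => isClosed_iInter fun _ => isClosed_eq (by fun_prop) continuous_const
  convert Matrix.isClosed_setOf_posSemidef.inter h using 1
  ext W
  rw [Set.mem_inter_iff, Set.mem_iInter₂]
  rfl

theorem isCompact_free : IsCompact (Free dI dO) := by
  have h := (Matrix.isCompact_setOf_posSemidef_trace_eq (α := ∀ i, Fin (dI i)) 1).image
    (f := (parallel : _ → Op dI dO))
    (continuous_matrix fun x y => by simp only [parallel, Matrix.of_apply]; fun_prop)
  convert h using 1
  ext W
  exact ⟨fun ⟨ρ, h1, h2, h3⟩ => ⟨ρ, ⟨h1, h2⟩, h3.symm⟩, fun ⟨ρ, ⟨h1, h2⟩, h3⟩ => ⟨ρ, h1, h2, h3.symm⟩⟩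

theorem convex_proc : Convex ℝ (Proc dI dO) := by
  rintro V ⟨hV, hV1⟩ W ⟨hW, hW1⟩ a b ha hb hab
  refine ⟨(hV.smul ha).add (hW.smul hb), fun M hM => ?_⟩
  rw [Matrix.transpose_add, Matrix.transpose_smul, Matrix.transpose_smul, add_mul, Matrix.smul_mul,
    Matrix.smul_mul, Matrix.trace_add, Matrix.trace_smul, Matrix.trace_smul, hV1 M hM, hW1 M hM]
  simpa using congrArg (algebraMap ℝ ℂ) hab

theorem isLeast_signallingRobustness (hO : ∀ i, 0 < dO i) {W : Op dI dO}
    (hne : (freeingWeights W).Nonempty) :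
    IsLeast (freeingWeights W) (signallingRobustness W) := by
  obtain ⟨s₀, hs₀⟩ := hne
  -- Truncating at one feasible weight `s₀` makes the set of feasible pairs `(s, T)` compact; its
  -- projection to `s` has a least element.
  have hK : IsCompact ((Set.Icc 0 s₀ ×ˢ Proc dI dO) ∩
      (fun p : ℝ × Op dI dO => (1 + p.1)⁻¹ • (W + p.1 • p.2)) ⁻¹' Free dI dO) := by
    refine (isCompact_Icc.prod (isCompact_proc hO)).of_isClosed_subset ?_ Set.inter_subset_left
    refine ContinuousOn.preimage_isClosed_of_isClosed ?_
      (isClosed_Icc.prod (isCompact_proc hO).isClosed) isCompact_free.isClosed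
    refine ContinuousOn.smul (ContinuousOn.inv₀ (f := fun p : ℝ × Op dI dO => 1 + p.1)
      (by fun_prop) fun p hp => ?_) (Continuous.continuousOn (by fun_prop))
    have := hp.1.1
    positivity
  have himage : Prod.fst '' ((Set.Icc 0 s₀ ×ˢ Proc dI dO) ∩
      (fun p : ℝ × Op dI dO => (1 + p.1)⁻¹ • (W + p.1 • p.2)) ⁻¹' Free dI dO) =
      freeingWeights W ∩ Set.Iic s₀ := by
    ext s
    constructor
    · rintro ⟨⟨s, T⟩, ⟨⟨hs, hT⟩, h⟩, rfl⟩
      exact ⟨⟨hs.1, T, hT, h⟩, hs.2⟩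
    · rintro ⟨⟨h0, T, hT, h⟩, hs⟩
      exact ⟨(s, T), ⟨⟨⟨h0, hs⟩, hT⟩, h⟩, rfl⟩
  have hc := himage ▸ hK.image continuous_fst
  obtain ⟨r, hr, hmin⟩ := hc.exists_isLeast ⟨s₀, hs₀, Set.self_mem_Iic⟩
  have hr' : IsLeast (freeingWeights W) r := ⟨hr.1, fun s hs => by
    rcases le_total s s₀ with h | h
    · exact hmin ⟨hs, h⟩
    · exact le_trans hr.2 h⟩
  rw [signallingRobustness, hr'.csInf_eq]
  exact hr'

/-! ### The operator bound and the complementary process -/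

theorem posSemidef_sub_of_mem_procLast (hO : ∀ i, 0 < dO i) {k : Fin N} {W : Op dI dO}
    (hW : W ∈ ProcLast dI dO k) :
    (((∏ j : {j // j ≠ k}, (dO j : ℝ)) ^ 2) • nonSignallingPart W - W).PosSemidef := by
  -- The output of `k` is grouped with the inputs, so that the second factor holds exactly the other
  -- outputs.
  let e : Idx dI dO ≃ ((∀ i, Fin (dI i)) × Fin (dO k)) × (∀ j : {j // j ≠ k}, Fin (dO j)) :=
    (Equiv.arrowProdEquivProdArrow _ _ _).trans
      ((Equiv.prodCongr (Equiv.refl _) (Equiv.piSplitAt k _)).trans (Equiv.prodAssoc _ _ _).symm)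
  have hne : ∀ i, (dO i : ℂ) ≠ 0 := fun i => Nat.cast_ne_zero.2 (hO i).ne'
  have hupd : ∀ a u b c, Function.update (e.symm ((a, u), b)) k ((e.symm ((a, u), b) k).1, c) =
      e.symm ((a, c), b) := by
    intro a u b c
    funext i
    by_cases h : i = k
    · subst h; simp [e]
    · simp [e, h]
  have hlast : ∀ a u a' u' b, W (e.symm ((a, u), b)) (e.symm ((a', u'), b)) =
      if u = u' then (dO k : ℂ)⁻¹ * ∑ c, W (e.symm ((a, c), b)) (e.symm ((a', c), b)) else 0 := by
    intro a u a' u' b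
    conv_lhs => rw [← hW.2]
    simp only [traceReplaceOutput, Matrix.of_apply, hupd]
    simp [e]
  have htr : ∀ a a', traceOutputs W a a' =
      ∑ b, ∑ c, W (e.symm ((a, c), b)) (e.symm ((a', c), b)) := by
    intro a a'
    rw [Finset.sum_comm, ← Fintype.sum_prod_type', traceOutputs, Matrix.of_apply,
      ← (Equiv.piSplitAt k fun i => Fin (dO i)).symm.sum_comp]
    rfl
  have h := ((hW.1.1.submatrix e.symm).card_smul_partialTraceSnd_kronecker_one_sub).submatrix e
  convert h using 1
  ext x y
  obtain ⟨⟨⟨a, u⟩, b⟩, rfl⟩ := e.symm.surjective x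
  obtain ⟨⟨⟨a', u'⟩, b'⟩, rfl⟩ := e.symm.surjective y
  have hI1 : ∀ a u b, (fun i => (e.symm ((a, u), b) i).1) = a := fun a u b => rfl
  have hO1 : ∀ a u b, (fun i => (e.symm ((a, u), b) i).2) =
    (Equiv.piSplitAt k fun i => Fin (dO i)).symm (u, b) := fun a u b => rfl
  simp only [Matrix.sub_apply, Matrix.smul_apply, Matrix.submatrix_apply, e.apply_symm_apply,
    Matrix.kroneckerMap_apply, Matrix.partialTraceSnd, Matrix.of_apply, nonSignallingPart, parallel,
    hI1, hO1, Matrix.one_apply, (Equiv.injective _).eq_iff, Prod.mk.injEq, htr]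
  -- The `W` terms cancel. What remains compares constants: with `P` the product of the other output
  -- dimensions, `P ^ 2 / (dO k * P) = P / dO k`.
  congr 1
  simp only [hlast a u a' u', Complex.real_smul]
  by_cases hu : u = u'
  · by_cases hb : b = b'
    · have hprod : (∏ i, (dO i : ℂ)) = dO k * ∏ j : {j // j ≠ k}, (dO j : ℂ) :=
        Fintype.prod_eq_mul_prod_subtype_ne _ k
      have hne' : (∏ j : {j // j ≠ k}, (dO j : ℂ)) ≠ 0 :=
        Finset.prod_ne_zero_iff.2 fun i _ => hne i
      have hnek := hne k
      simp only [hu, hb, and_self, if_true, ← Finset.mul_sum, Fintype.card_pi, Fintype.card_fin]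
      push_cast
      rw [hprod]
      field_simp
    · simp [hb]
  · simp [hu]

theorem posSemidef_sub_of_mem_procLastConv (hO : ∀ i, 0 < dO i) {D : ℝ}
    (hD : ∀ k : Fin N, (∏ j : {j // j ≠ k}, (dO j : ℝ)) ^ 2 ≤ D) {W : Op dI dO}
    (hW : W ∈ ProcLastConv dI dO) :
    W ∈ Proc dI dO ∧ (D • nonSignallingPart W - W).PosSemidef := by
  refine convexHull_min (t := {W | W ∈ Proc dI dO ∧ (D • nonSignallingPart W - W).PosSemidef})
    ?_ ?_ hW
  · refine Set.iUnion_subset fun k V hV => ⟨hV.1, ?_⟩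
    obtain ⟨ρ, hρ, -, hVρ⟩ := nonSignallingPart_mem_free hO hV.1
    have h := (posSemidef_sub_of_mem_procLast hO hV).add
      ((hVρ ▸ posSemidef_parallel hρ : (nonSignallingPart V).PosSemidef).smul
        (sub_nonneg.2 (hD k)))
    convert h using 1
    module
  · rintro U ⟨hU, hU'⟩ V ⟨hV, hV'⟩ a b ha hb hab
    refine ⟨convex_proc hU hV ha hb hab, ?_⟩
    convert (hU'.smul ha).add (hV'.smul hb) using 1
    rw [nonSignallingPart_add, nonSignallingPart_smul, nonSignallingPart_smul]
    module

theorem sub_one_mem_freeingWeights (hO : ∀ i, 0 < dO i) {D : ℝ} (hD : 1 ≤ D) {W : Op dI dO}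
    (hW : W ∈ Proc dI dO) (hpos : (D • nonSignallingPart W - W).PosSemidef) :
    D - 1 ∈ freeingWeights W := by
  have hfree := nonSignallingPart_mem_free hO hW
  have hproc := free_subset_proc hfree
  refine ⟨sub_nonneg.2 hD, ?_⟩
  rcases hD.eq_or_lt with rfl | hD
  -- For `D = 1` no division is possible, but a positive matrix of trace zero vanishes, so `W` is
  -- itself free.
  · have hzero : nonSignallingPart W - W = 0 := by
      rw [one_smul] at hpos
      rw [← hpos.trace_eq_zero_iff, Matrix.trace_sub, trace_of_mem_proc hO hW,
        trace_of_mem_proc hO hproc, sub_self]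
    refine ⟨W, hW, ?_⟩
    simpa [sub_eq_zero.1 hzero] using hfree
  · have hD1 : 0 < D - 1 := sub_pos.2 hD
    refine ⟨(D - 1)⁻¹ • (D • nonSignallingPart W - W),
      ⟨hpos.smul (inv_nonneg.2 hD1.le), fun M hM => ?_⟩, ?_⟩
    · rw [Matrix.transpose_smul, Matrix.transpose_sub, Matrix.transpose_smul, Matrix.smul_mul,
        sub_mul, Matrix.smul_mul, Matrix.trace_smul, Matrix.trace_sub, Matrix.trace_smul,
        hW.2 M hM, hproc.2 M hM, Complex.real_smul, Complex.real_smul, mul_one]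
      have : (D : ℂ) - 1 ≠ 0 := by exact_mod_cast hD1.ne'
      push_cast
      exact inv_mul_cancel₀ this
    · rw [smul_inv_smul₀ hD1.ne', add_sub_cancel, add_sub_cancel, inv_smul_smul₀ (by positivity)]
      exact hfree

end ProcessMatrix

/-- There are `n + 1` parties. A causal order is a permutation `π`, with last party
`π (Fin.last n)`, and the maximum is over all of them. The first conjunct says that the minimum that
defines the robustness of `W` exists. -/
theorem mainTheorem12 (n : ℕ) (dI dO : Fin (n + 1) → ℕ)
    (hI : ∀ i, 0 < dI i) (hO : ∀ i, 0 < dO i)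
    (W : ProcessMatrix.Op dI dO) (hW : W ∈ ProcessMatrix.ProcLastConv dI dO) :
    IsLeast (ProcessMatrix.freeingWeights W) (ProcessMatrix.signallingRobustness W) ∧
      ProcessMatrix.signallingRobustness W ≤
        Finset.univ.sup' Finset.univ_nonempty (fun π : Equiv.Perm (Fin (n + 1)) =>
          (∏ i : Fin n, (dO (π i.castSucc) : ℝ) ^ 2) - 1) := by
  -- The added `1` makes `D - 1` the claimed bound.
  let D : ℝ := Finset.univ.sup' Finset.univ_nonempty (fun π : Equiv.Perm (Fin (n + 1)) =>
    (∏ i : Fin n, (dO (π i.castSucc) : ℝ) ^ 2) - 1) + 1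
  have hD : ∀ k : Fin (n + 1), (∏ j : {j // j ≠ k}, (dO j : ℝ)) ^ 2 ≤ D := by
    intro k
    have hk : (dO k : ℝ) ≠ 0 := Nat.cast_ne_zero.2 (hO k).ne'
    -- Swapping `k` with the last index gives an order that ends in `k`.
    have hperm : ∏ i : Fin n, (dO (Equiv.swap k (Fin.last n) i.castSucc) : ℝ) =
        ∏ j : {j // j ≠ k}, (dO j : ℝ) := by
      have h := Equiv.prod_comp (Equiv.swap k (Fin.last n)) fun i => (dO i : ℝ)
      rw [Fin.prod_univ_castSucc, Equiv.swap_apply_right,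
        Fintype.prod_eq_mul_prod_subtype_ne _ k, mul_comm] at h
      exact mul_left_cancel₀ hk h
    rw [← hperm, ← Finset.prod_pow]
    exact sub_le_iff_le_add.1 (Finset.le_sup' (fun π : Equiv.Perm (Fin (n + 1)) =>
      (∏ i : Fin n, (dO (π i.castSucc) : ℝ) ^ 2) - 1) (Finset.mem_univ _))
  have hD1 : 1 ≤ D := by
    refine le_trans (one_le_pow₀ ?_) (hD 0)
    rw [← Nat.cast_prod]
    exact Nat.one_le_cast.2 (Nat.succ_le_of_lt (Finset.prod_pos fun i _ => hO i.1))
  obtain ⟨hWP, hpos⟩ := ProcessMatrix.posSemidef_sub_of_mem_procLastConv hO hD hW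
  have hmem := ProcessMatrix.sub_one_mem_freeingWeights hO hD1 hWP hpos
  have hleast := ProcessMatrix.isLeast_signallingRobustness hO ⟨_, hmem⟩
  exact ⟨hleast, (hleast.2 hmem).trans_eq (add_sub_cancel_right _ _)⟩
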